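/- Let $\mathcal H$ be a complex Hilbert space and $T$ a bounded linear operator on $\mathcal H$. For a bounded operator $S$ on a Hilbert space put $\Delta_S=S^*S-I$ and $\operatorname{cov}(S)=\|\Delta_S\|^{1/2}$. $S$ is *concave* if $\|S^2x\|^2-2\|Sx\|^2+\|x\|^2\le 0$ for all $x$ (then $\Delta_S\ge 0$), and a *2-isometry* if $S^*\Delta_SS=\Delta_S$. A *model extension* of $T$ consists of Hilbert spaces $\mathcal M_0,\mathcal M_1$, an isometry $Z:\mathcal H\to\mathcal M_0\oplus\mathcal M_1$ and an operator $$T_1=\begin{pmatrix}V&\delta E_1\\0&W\end{pmatrix}\quad\text{on }\mathcal M_0\oplus\mathcal M_1,\qquad \delta=\|\Delta_T\|^{1/2},$$ with $ZT=T_1Z$, where $V$, $W$ are isometries, $E_1:\mathcal M_1\to\mathcal M_0$ is a contraction, $V^*E_1=0$ and $W^*E_1^*E_1W\le E_1^*E_1$. It is called *tight* if $P_{\mathcal M_1}Z\mathcal H$ is dense in $\mathcal M_1$. (i) $T$ is concave if and only if it has a model extension. In this case every model extension $T_1$ of $T$ is concave and $\|\Delta_{T_1}\|^{1/2}=\delta$.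 (ii) Let $T$ be concave. Then $T$ has a tight model extension. For every tight model extension $T_1$, $\Delta_T^{1/2}T^n\to0$ strongly if and only if $\Delta_{T_1}^{1/2}T_1^n\to0$ strongly; the implication from $T_1$ to $T$ holds for every model extension. If $\Delta_{T_1}^{1/2}T_1^n\to 0$ strongly for some model extension $T_1$, or if $\Delta_T^{1/2}T^n\to0$ strongly and $T_1$ is a tight model extension, then $n^{-1/2}T^n\to0$ and $n^{-1/2}T_1^n\to0$ strongly. (iii) If $T$ is concave, then $T$ has a minimal 2-isometric lifting of type I and of covariance $\|\Delta_T\|^{1/2}$. That is, there are a Hilbert space $\mathcal K$, an isometry $J:\mathcal H\to\mathcal K$ and a 2-isometry $S$ on $\mathcal K$ such that $J^*S=TJ^*$, $\mathcal K$ is the closed linear span of $\bigcup_{n\ge0}S^nJ\mathcal H$, $(J\mathcal H)^\perp\subset\ker\Delta_S$, and $\operatorname{cov}(S)=\|\Delta_T\|^{1/2}$. -/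

import Mathlib

open Filter Topology ContinuousLinearMap
open scoped InnerProductSpace

universe u v

noncomputable section

namespace ConcaveOp

section Basic

variable {H : Type u} [NormedAddCommGroup H] [InnerProductSpace ℂ H] [CompleteSpace H]

/-- The covariance operator `Δ_T = T* T - I`. -/
def Delta (T : H →L[ℂ] H) : H →L[ℂ] H := adjoint T ∘L T - 1

/-- The covariance `cov(T) = ‖Δ_T‖^{1/2}`. -/
def cov (T : H →L[ℂ] H) : ℝ := Real.sqrt ‖Delta T‖

/-- `T` is concave: `‖T²x‖² - 2‖Tx‖² + ‖x‖² ≤ 0` for every `x`. -/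
def IsConcave (T : H →L[ℂ] H) : Prop :=
  ∀ x : H, ‖T (T x)‖ ^ 2 - 2 * ‖T x‖ ^ 2 + ‖x‖ ^ 2 ≤ 0

/-- `T` is a 2-isometry: `T* Δ_T T = Δ_T`. -/
def IsTwoIsometry (T : H →L[ℂ] H) : Prop :=
  adjoint T ∘L Delta T ∘L T = Delta T

/-- `Δ_T^{1/2} T^n → 0` strongly, where `Δ_T^{1/2}` is the positive square root of `Δ_T`;
`Δ_T` is positive for concave `T`, see `IsConcave.delta_nonneg`. -/
def DeltaStable (T : H →L[ℂ] H) : Prop :=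
  ∀ x : H, Tendsto (fun n : ℕ => CFC.sqrt (Delta T) ((T ^ n) x)) atTop (𝓝 0)

/-- `n^{-1/2} T^n → 0` strongly. -/
def RootPowersTendToZero (T : H →L[ℂ] H) : Prop :=
  ∀ x : H, Tendsto (fun n : ℕ => (((Real.sqrt (n : ℝ))⁻¹ : ℝ) : ℂ) • (T ^ n) x) atTop (𝓝 0)

theorem re_inner_delta (T : H →L[ℂ] H) (x : H) :
    (Delta T).reApplyInnerSelf x = ‖T x‖ ^ 2 - ‖x‖ ^ 2 := by
  have h1 : (Delta T) x = adjoint T (T x) - x := rfl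
  rw [ContinuousLinearMap.reApplyInnerSelf_apply, h1, inner_sub_left, map_sub,
    ContinuousLinearMap.adjoint_inner_left, inner_self_eq_norm_sq, inner_self_eq_norm_sq]

/-- A concave operator is expansive, so that the square root of `Δ_T` is meaningful. -/
theorem IsConcave.delta_nonneg {T : H →L[ℂ] H} (hT : IsConcave T) : 0 ≤ Delta T := by
  rw [ContinuousLinearMap.nonneg_iff_isPositive, ContinuousLinearMap.isPositive_def]
  have hsymm : IsSelfAdjoint (Delta T) := by
    have h1 : IsSelfAdjoint (star T * T) := IsSelfAdjoint.star_mul_self T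
    exact h1.sub (IsSelfAdjoint.one _)
  refine ⟨hsymm.isSymmetric, fun x => ?_⟩
  rw [re_inner_delta]
  have step : ∀ n : ℕ, ‖(T ^ (n + 1)) x‖ ^ 2 - ‖(T ^ n) x‖ ^ 2 ≤ ‖T x‖ ^ 2 - ‖x‖ ^ 2 := by
    intro n
    induction n with
    | zero => simp
    | succ k ih =>
      have h := hT ((T ^ k) x)
      have e1 : (T ^ (k + 1)) x = T ((T ^ k) x) := by rw [pow_succ']; rfl
      have e2 : (T ^ (k + 1 + 1)) x = T (T ((T ^ k) x)) := by
        rw [pow_succ', pow_succ']; rfl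
      rw [e1] at ih ⊢
      rw [e2]
      linarith
  have bound : ∀ n : ℕ, ‖(T ^ n) x‖ ^ 2 ≤ ‖x‖ ^ 2 + n * (‖T x‖ ^ 2 - ‖x‖ ^ 2) := by
    intro n
    induction n with
    | zero => simp
    | succ k ih =>
      have h := step k
      rw [Nat.cast_succ]
      linarith
  by_contra hneg
  push Not at hneg
  obtain ⟨n, hn⟩ := exists_nat_gt (‖x‖ ^ 2 / (‖x‖ ^ 2 - ‖T x‖ ^ 2))
  rw [div_lt_iff₀ (by linarith)] at hn
  have h1 := bound n
  have h2 := sq_nonneg ‖(T ^ n) x‖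
  linarith

end Basic

section Block

variable {M₀ M₁ : Type v} [NormedAddCommGroup M₀] [InnerProductSpace ℂ M₀]
  [NormedAddCommGroup M₁] [InnerProductSpace ℂ M₁]

/-- The upper triangular operator matrix `[[A, B], [0, D]]` on the Hilbert space direct sum
`M₀ ⊕ M₁`. -/
def upperBlock (A : M₀ →L[ℂ] M₀) (B : M₁ →L[ℂ] M₀) (D : M₁ →L[ℂ] M₁) :
    WithLp 2 (M₀ × M₁) →L[ℂ] WithLp 2 (M₀ × M₁) :=
  ((WithLp.prodContinuousLinearEquiv 2 ℂ M₀ M₁).symm : (M₀ × M₁) →L[ℂ] WithLp 2 (M₀ × M₁)) ∘L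
    ((A ∘L ContinuousLinearMap.fst ℂ M₀ M₁ + B ∘L ContinuousLinearMap.snd ℂ M₀ M₁).prod
      (D ∘L ContinuousLinearMap.snd ℂ M₀ M₁)) ∘L
    ((WithLp.prodContinuousLinearEquiv 2 ℂ M₀ M₁) : WithLp 2 (M₀ × M₁) →L[ℂ] (M₀ × M₁))

theorem upperBlock_apply (A : M₀ →L[ℂ] M₀) (B : M₁ →L[ℂ] M₀) (D : M₁ →L[ℂ] M₁)
    (x : M₀) (y : M₁) :
    upperBlock A B D (WithLp.toLp 2 (x, y)) = WithLp.toLp 2 (A x + B y, D y) := rfl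

end Block

section Model

variable {H : Type u} [NormedAddCommGroup H] [InnerProductSpace ℂ H] [CompleteSpace H]
  {M₀ M₁ : Type v} [NormedAddCommGroup M₀] [InnerProductSpace ℂ M₀] [CompleteSpace M₀]
  [NormedAddCommGroup M₁] [InnerProductSpace ℂ M₁] [CompleteSpace M₁]

/-- The operator `T₁ = [[V, δ E₁], [0, W]]` on `M₀ ⊕ M₁` with `δ = ‖Δ_T‖^{1/2}`. -/
def model (T : H →L[ℂ] H) (V : M₀ →L[ℂ] M₀) (E₁ : M₁ →L[ℂ] M₀) (W : M₁ →L[ℂ] M₁) :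
    WithLp 2 (M₀ × M₁) →L[ℂ] WithLp 2 (M₀ × M₁) :=
  upperBlock V (((cov T : ℝ) : ℂ) • E₁) W

/-- `V`, `W` are isometries, `E₁` is a contraction with `V* E₁ = 0` and
`W* E₁* E₁ W ≤ E₁* E₁`, and `T₁ = [[V, δ E₁], [0, W]]` with `δ = ‖Δ_T‖^{1/2}` is an extension
of `T` through the isometric embedding `Z : H → M₀ ⊕ M₁`, that is `Z T = T₁ Z`. -/
structure IsModelExtension (T : H →L[ℂ] H) (V : M₀ →L[ℂ] M₀) (E₁ : M₁ →L[ℂ] M₀)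
    (W : M₁ →L[ℂ] M₁) (Z : H →ₗᵢ[ℂ] WithLp 2 (M₀ × M₁)) : Prop where
  isometry_V : adjoint V ∘L V = 1
  isometry_W : adjoint W ∘L W = 1
  contraction : ‖E₁‖ ≤ 1
  orthogonal : adjoint V ∘L E₁ = 0
  le : adjoint W ∘L adjoint E₁ ∘L E₁ ∘L W ≤ adjoint E₁ ∘L E₁
  intertwines : ∀ x : H, Z (T x) = model T V E₁ W (Z x)

/-- The image of `H` under the orthogonal projection of `M₀ ⊕ M₁` onto `M₁` is dense in `M₁`. -/
def IsTight (Z : H →ₗᵢ[ℂ] WithLp 2 (M₀ × M₁)) : Prop :=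
  DenseRange fun x : H => (Z x).snd

end Model

section Lifting

variable {H : Type u} [NormedAddCommGroup H] [InnerProductSpace ℂ H] [CompleteSpace H]
  {K : Type v} [NormedAddCommGroup K] [InnerProductSpace ℂ K] [CompleteSpace K]

/-- `S` on `K ⊇ J H` is a lifting of `T` on `H`: `J* S = T J*`. Here `J` is the embedding of `H`
into `K`, so that `J*` is the projection of `K` onto `H`. -/
def IsLifting (T : H →L[ℂ] H) (S : K →L[ℂ] K) (J : H →ₗᵢ[ℂ] K) : Prop :=
  adjoint J.toContinuousLinearMap ∘L S = T ∘L adjoint J.toContinuousLinearMap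

/-- Minimality of a lifting: `K` is the closed linear span of `Sⁿ H`, `n ≥ 0`. -/
def IsMinimalLifting (S : K →L[ℂ] K) (J : H →ₗᵢ[ℂ] K) : Prop :=
  (Submodule.span ℂ {y : K | ∃ (n : ℕ) (x : H), y = (S ^ n) (J x)}).topologicalClosure = ⊤

/-- Type I: the orthogonal complement of `H` in `K` lies in the kernel of `Δ_S`. -/
def IsTypeI (S : K →L[ℂ] K) (J : H →ₗᵢ[ℂ] K) : Prop :=
  ∀ y : K, (∀ x : H, ⟪J x, y⟫_ℂ = 0) → Delta S y = 0

end Lifting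

end ConcaveOp

end

/-!
For concave `T` one has `0 ≤ Δ_T` and `T* Δ_T T ≤ Δ_T`. Put `D = Δ_T / ‖Δ_T‖`. Both existence
results rest on one fact (`ConcaveOp.IsConcave.exists_invariant`): there is an operator `A` with
`D ≤ A ≤ I` and `T* A T = A`. Every operator in the order interval `[D, I]` has the form `T* Y T`
with `Y` in the same interval, by Douglas' factorization lemma (`ConcaveOp.exists_le_conj_eq`); a
fixed point is a weak limit of the means of a backward orbit (`ConcaveOp.exists_invariant`).

* The seminorm `⟪A x, x⟫^{1/2}` is preserved by `T`, so `T` induces an isometry `W` on the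
  completion `M₁`, and `D^{1/2}` factors through `M₁` by a contraction because `D ≤ A`. The remaining
  form `I - A` satisfies `‖(I - A)^{1/2} T x‖² = ‖(I - A)^{1/2} x‖² + ‖Δ_T^{1/2} x‖²`, and a
  Schäffer-type dilation of this isometric correspondence (`ConcaveOp.exists_row_isometry`) provides
  `M₀` and `V`. This is a tight model extension (`ConcaveOp.IsConcave.exists_tight_model`).
* A lifting `S` whose form `Δ_S` is `‖Δ_T‖ A` on `H` and zero on the complement of `H` is a 2-isometry
  of type I and of the right covariance; it is restricted to the closed span of the `Sⁿ H`
  (`ConcaveOp.IsConcave.exists_lifting`, `ConcaveOp.exists_minimal_restriction`).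

The statements on a given model extension `T₁` follow from the identity
`‖T₁ m‖² = ‖m‖² + δ² ‖E₁ m₁‖²` (`ConcaveOp.IsModelExtension.norm_sq_model`). For concave operators,
`‖Δ_T^{1/2} Tⁿ x‖²` is an increment of the sequence `‖Tⁿ x‖²`, so its convergence to zero gives
`‖Tⁿ x‖² / n → 0` by Cesàro means.
-/

namespace ConcaveOp

/-! ### Positive operators and their quadratic forms -/

section Forms

variable {H : Type*} [NormedAddCommGroup H] [InnerProductSpace ℂ H]

theorem reApplyInnerSelf_one (x : H) : (1 : H →L[ℂ] H).reApplyInnerSelf x = ‖x‖ ^ 2 := by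
  simp [reApplyInnerSelf_apply, inner_self_eq_norm_sq_to_K, ← Complex.ofReal_pow]

theorem reApplyInnerSelf_sub (P Q : H →L[ℂ] H) (x : H) :
    (P - Q).reApplyInnerSelf x = P.reApplyInnerSelf x - Q.reApplyInnerSelf x := by
  simp [reApplyInnerSelf_apply, inner_sub_left]

theorem reApplyInnerSelf_add (P Q : H →L[ℂ] H) (x : H) :
    (P + Q).reApplyInnerSelf x = P.reApplyInnerSelf x + Q.reApplyInnerSelf x := by
  simp [reApplyInnerSelf_apply, inner_add_left]

theorem reApplyInnerSelf_smul (c : ℝ) (P : H →L[ℂ] H) (x : H) :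
    (c • P).reApplyInnerSelf x = c * P.reApplyInnerSelf x := by
  simp [reApplyInnerSelf_apply, inner_smul_left_eq_star_smul]

theorem reApplyInnerSelf_le (P : H →L[ℂ] H) (x : H) :
    P.reApplyInnerSelf x ≤ ‖P‖ * ‖x‖ ^ 2 := by
  rw [reApplyInnerSelf_apply]
  calc _ ≤ ‖P x‖ * ‖x‖ := re_inner_le_norm _ _
    _ ≤ ‖P‖ * ‖x‖ * ‖x‖ := by gcongr; exact P.le_opNorm x
    _ = _ := by ring

variable [CompleteSpace H]

theorem isSelfAdjoint_Delta (T : H →L[ℂ] H) : IsSelfAdjoint (Delta T) :=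
  IsSelfAdjoint.sub (IsSelfAdjoint.star_mul_self T) (IsSelfAdjoint.one _)

theorem nonneg_iff_reApplyInnerSelf {P : H →L[ℂ] H} (hP : IsSelfAdjoint P) :
    0 ≤ P ↔ ∀ x, 0 ≤ P.reApplyInnerSelf x := by
  rw [nonneg_iff_isPositive, isPositive_def']
  exact ⟨fun h => h.2, fun h => ⟨hP, h⟩⟩

theorem le_iff_reApplyInnerSelf {P Q : H →L[ℂ] H} (hP : IsSelfAdjoint P) (hQ : IsSelfAdjoint Q) :
    P ≤ Q ↔ ∀ x, P.reApplyInnerSelf x ≤ Q.reApplyInnerSelf x := by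
  rw [← sub_nonneg, nonneg_iff_reApplyInnerSelf (hQ.sub hP)]
  simp [reApplyInnerSelf_apply, inner_sub_left]

/-- A self-adjoint operator is determined by its quadratic form. -/
theorem eq_of_reApplyInnerSelf_eq {P Q : H →L[ℂ] H} (hP : IsSelfAdjoint P)
    (hQ : IsSelfAdjoint Q) (h : ∀ x, P.reApplyInnerSelf x = Q.reApplyInnerSelf x) : P = Q :=
  le_antisymm ((le_iff_reApplyInnerSelf hP hQ).2 fun x => (h x).le)
    ((le_iff_reApplyInnerSelf hQ hP).2 fun x => (h x).ge)

theorem norm_sqrt_apply_sq {P : H →L[ℂ] H} (hP : 0 ≤ P) (x : H) :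
    ‖CFC.sqrt P x‖ ^ 2 = P.reApplyInnerSelf x := by
  have h1 : IsSelfAdjoint (CFC.sqrt P) := (CFC.sqrt_nonneg P).isSelfAdjoint
  have h2 : P x = CFC.sqrt P (CFC.sqrt P x) := by
    conv_lhs => rw [← CFC.sqrt_mul_sqrt_self P hP]
    rfl
  rw [reApplyInnerSelf_apply, h2, ← adjoint_inner_right, h1.adjoint_eq]
  exact (inner_self_eq_norm_sq (𝕜 := ℂ) _).symm

variable {F : Type*} [NormedAddCommGroup F] [InnerProductSpace ℂ F] [CompleteSpace F]

theorem reApplyInnerSelf_conj (P : F →L[ℂ] F) (S : H →L[ℂ] F) (x : H) :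
    (adjoint S ∘L P ∘L S).reApplyInnerSelf x = P.reApplyInnerSelf (S x) := by
  simp [reApplyInnerSelf_apply, adjoint_inner_left]

theorem reApplyInnerSelf_adjoint_comp_self (S : H →L[ℂ] F) (x : H) :
    (adjoint S ∘L S).reApplyInnerSelf x = ‖S x‖ ^ 2 := by
  simp [reApplyInnerSelf_apply, adjoint_inner_left, inner_self_eq_norm_sq_to_K, ← Complex.ofReal_pow]

theorem norm_le_of_reApplyInnerSelf_le {P : H →L[ℂ] H} (hP : 0 ≤ P) {c : ℝ} (hc : 0 ≤ c)
    (h : ∀ x, P.reApplyInnerSelf x ≤ c * ‖x‖ ^ 2) : ‖P‖ ≤ c := by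
  have hs : ‖CFC.sqrt P‖ ≤ √c := by
    refine opNorm_le_bound _ (Real.sqrt_nonneg c) fun x => ?_
    rw [← sq_le_sq₀ (norm_nonneg _) (by positivity), norm_sqrt_apply_sq hP, mul_pow,
      Real.sq_sqrt hc]
    exact h x
  calc ‖P‖ = ‖CFC.sqrt P * CFC.sqrt P‖ := by rw [CFC.sqrt_mul_sqrt_self P hP]
    _ ≤ ‖CFC.sqrt P‖ * ‖CFC.sqrt P‖ := norm_mul_le _ _
    _ ≤ √c * √c := by gcongr
    _ = c := Real.mul_self_sqrt hc

end Forms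

/-! ### Factorization through a contraction and weak operator limits -/

section Factor

variable {E : Type*} [NormedAddCommGroup E] [NormedSpace ℂ E]
  {F : Type*} [NormedAddCommGroup F] [InnerProductSpace ℂ F]

/-- The operator `B`, regarded as a map into the closure of its range. -/
def _root_.ContinuousLinearMap.toRangeClosure (B : E →L[ℂ] F) :
    E →L[ℂ] B.range.topologicalClosure :=
  B.codRestrict _ fun x => Submodule.le_topologicalClosure _ ⟨x, rfl⟩

theorem _root_.ContinuousLinearMap.denseRange_toRangeClosure (B : E →L[ℂ] F) :
    DenseRange B.toRangeClosure := by
  intro y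
  rw [Topology.IsInducing.subtypeVal.closure_eq_preimage_closure_image]
  refine closure_mono ?_ y.2
  rintro _ ⟨x, rfl⟩
  exact ⟨_, ⟨x, rfl⟩, rfl⟩

variable [CompleteSpace F]
  {G : Type*} [NormedAddCommGroup G] [InnerProductSpace ℂ G] [CompleteSpace G]

instance (B : E →L[ℂ] F) : CompleteSpace B.range.topologicalClosure :=
  (Submodule.isClosed_topologicalClosure _).completeSpace_coe

/-- Douglas' lemma: if `‖D x‖ ≤ ‖B x‖` for all `x`, then `D` factors through `B` by a
contraction. -/
theorem exists_contraction_comp_eq (B : E →L[ℂ] F) (D : E →L[ℂ] G) (h : ∀ x, ‖D x‖ ≤ ‖B x‖) :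
    ∃ C : F →L[ℂ] G, ‖C‖ ≤ 1 ∧ ∀ x, C (B x) = D x := by
  let R : Submodule ℂ F := B.range.topologicalClosure
  have hdense : DenseRange B.toRangeClosure := B.denseRange_toRangeClosure
  let e : E →ₗ[ℂ] R := B.toRangeClosure.toLinearMap
  have hn : ∀ x, ‖D.toLinearMap x‖ ≤ 1 * ‖e x‖ := fun x => by rw [one_mul]; exact h x
  refine ⟨D.toLinearMap.extendOfNorm e ∘L R.orthogonalProjectionOnto, ?_, fun x => ?_⟩
  · refine opNorm_le_bound _ zero_le_one fun y => ?_
    refine (LinearMap.norm_extendOfNorm_apply_le hdense 1 hn _).trans ?_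
    rw [one_mul, one_mul]
    exact R.norm_orthogonalProjectionOnto_apply_le y
  · have h1 : R.orthogonalProjectionOnto (B x) = e x :=
      R.orthogonalProjectionOnto_mem_subspace_eq_self (B.toRangeClosure x)
    rw [comp_apply, h1, LinearMap.extendOfNorm_eq hdense ⟨1, hn⟩]
    rfl

/-- Weak operator compactness of the unit ball: a sequence of contractions has a weak operator
limit along every ultrafilter. -/
theorem exists_weak_limit (𝓤 : Ultrafilter ℕ) (S : ℕ → F →L[ℂ] F) (hS : ∀ n, ‖S n‖ ≤ 1) :
    ∃ A : F →L[ℂ] F, ∀ x y, Tendsto (fun n => ⟪S n x, y⟫_ℂ) 𝓤 (𝓝 ⟪A x, y⟫_ℂ) := by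
  have hb : ∀ x y n, ‖⟪S n x, y⟫_ℂ‖ ≤ 1 * ‖x‖ * ‖y‖ := fun x y n =>
    (norm_inner_le_norm _ _).trans (by gcongr; exact (S n).le_of_opNorm_le (hS n) x)
  have hl : ∀ x y, ∃ l, Tendsto (fun n => ⟪S n x, y⟫_ℂ) 𝓤 (𝓝 l) := fun x y => by
    obtain ⟨l, -, hl⟩ := (isCompact_closedBall (0 : ℂ) (1 * ‖x‖ * ‖y‖)).ultrafilter_le_nhds'
      (𝓤.map fun n => ⟪S n x, y⟫_ℂ) (Filter.mem_map.2 <| Filter.univ_mem' fun n => by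
        simpa using hb x y n)
    exact ⟨l, hl⟩
  choose f hf using hl
  let φ : F →ₗ⋆[ℂ] F →ₗ[ℂ] ℂ := LinearMap.mk₂'ₛₗ (starRingEnd ℂ) (RingHom.id ℂ) f
    (fun x x' y => tendsto_nhds_unique (hf _ _)
      (((hf x y).add (hf x' y)).congr fun n => by rw [map_add, inner_add_left]))
    (fun c x y => tendsto_nhds_unique (hf _ _)
      (((hf x y).const_mul (starRingEnd ℂ c)).congr fun n => by rw [map_smul, inner_smul_left]))
    (fun x y y' => tendsto_nhds_unique (hf _ _)
      (((hf x y).add (hf x y')).congr fun n => by rw [inner_add_right]))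
    (fun c x y => tendsto_nhds_unique (hf _ _)
      (((hf x y).const_mul c).congr fun n => by rw [inner_smul_right]))
  refine ⟨InnerProductSpace.continuousLinearMapOfBilin (φ.mkContinuous₂ 1 fun x y =>
    le_of_tendsto (hf x y).norm (Eventually.of_forall (hb x y))), fun x y => ?_⟩
  rw [InnerProductSpace.continuousLinearMapOfBilin_apply]
  exact hf x y

end Factor

/-! ### An invariant form between `D` and the identity -/

section Invariant

variable {H : Type*} [NormedAddCommGroup H] [InnerProductSpace ℂ H] [CompleteSpace H]

/-- The compression `Y ↦ T* Y T` maps some operator between `D` and `I` to any prescribed `A`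
between `D` and `I`. With `R = (I - D)^{1/2}`, the inequality `A - T* D T ≤ T* R² T` and Douglas'
lemma give a contraction `C` with `C R T = (A - T* D T)^{1/2}`, and `Y = D + R C* C R` works. -/
theorem exists_le_conj_eq {T D A : H →L[ℂ] H}
    (hD1 : D ≤ 1) (hTD : adjoint T ∘L D ∘L T ≤ D)
    (hT : 1 ≤ adjoint T ∘L T) (hDA : D ≤ A) (hA1 : A ≤ 1) :
    ∃ Y : H →L[ℂ] H, D ≤ Y ∧ Y ≤ 1 ∧ adjoint T ∘L Y ∘L T = A := by
  have hR : 0 ≤ 1 - D := sub_nonneg.2 hD1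
  have hP : 0 ≤ A - adjoint T ∘L D ∘L T := sub_nonneg.2 (hTD.trans hDA)
  set R := CFC.sqrt (1 - D) with hRdef
  have hRsa : adjoint R = R := (CFC.sqrt_nonneg (1 - D)).isSelfAdjoint.adjoint_eq
  have hDsa : IsSelfAdjoint D := by
    simpa using (IsSelfAdjoint.one (H →L[ℂ] H)).sub hR.isSelfAdjoint
  have hAsa : IsSelfAdjoint A := by
    simpa using (IsSelfAdjoint.one (H →L[ℂ] H)).sub (sub_nonneg.2 hA1).isSelfAdjoint
  have hTT : IsSelfAdjoint (adjoint T ∘L T) := IsSelfAdjoint.star_mul_self T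
  have h1 (x : H) : A.reApplyInnerSelf x ≤ ‖T x‖ ^ 2 := by
    rw [← reApplyInnerSelf_adjoint_comp_self]
    exact (le_iff_reApplyInnerSelf hAsa hTT).1 (hA1.trans hT) x
  obtain ⟨C, hC, hCx⟩ := exists_contraction_comp_eq (R ∘L T)
      (CFC.sqrt (A - adjoint T ∘L D ∘L T)) fun x => by
    rw [← sq_le_sq₀ (norm_nonneg _) (norm_nonneg _), norm_sqrt_apply_sq hP, comp_apply,
      norm_sqrt_apply_sq hR, reApplyInnerSelf_sub, reApplyInnerSelf_sub, reApplyInnerSelf_conj,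
      reApplyInnerSelf_one]
    linarith [h1 x]
  have hGsa : IsSelfAdjoint (adjoint (C ∘L R) ∘L (C ∘L R)) :=
    IsSelfAdjoint.star_mul_self (C ∘L R)
  have hYsa : IsSelfAdjoint (D + adjoint (C ∘L R) ∘L (C ∘L R)) := hDsa.add hGsa
  refine ⟨D + adjoint (C ∘L R) ∘L (C ∘L R), ?_, ?_, ?_⟩
  · rw [le_iff_reApplyInnerSelf hDsa hYsa]
    intro x
    rw [reApplyInnerSelf_add, reApplyInnerSelf_adjoint_comp_self]
    linarith [sq_nonneg ‖(C ∘L R) x‖]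
  · rw [le_iff_reApplyInnerSelf hYsa (IsSelfAdjoint.one _)]
    intro x
    have h2 : ‖C (R x)‖ ^ 2 ≤ ‖R x‖ ^ 2 := by gcongr; simpa using C.le_of_opNorm_le hC (R x)
    rw [norm_sqrt_apply_sq hR, reApplyInnerSelf_sub] at h2
    rw [reApplyInnerSelf_add, reApplyInnerSelf_adjoint_comp_self, comp_apply]
    linarith
  · refine eq_of_reApplyInnerSelf_eq (hYsa.adjoint_conj T) hAsa fun x => ?_
    have h3 := hCx x
    rw [comp_apply] at h3
    rw [reApplyInnerSelf_conj, reApplyInnerSelf_add, reApplyInnerSelf_adjoint_comp_self,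
      comp_apply, h3, norm_sqrt_apply_sq hP, reApplyInnerSelf_sub, reApplyInnerSelf_conj]
    ring

/-- A fixed point of `A ↦ T* A T` between `D` and `I`. Iterating the right inverse of the map on the
order interval `[D, I]` gives operators `aₙ` with `T* aₙ₊₁ T = aₙ`; their means move under the map by
`O(1/n)`, so every weak limit of the means is a fixed point. The map need not send `[D, I]` into
itself, which is why it is inverted rather than iterated. -/
theorem exists_invariant {T D : H →L[ℂ] H} (hD0 : 0 ≤ D)
    (hD1 : D ≤ 1) (hTD : adjoint T ∘L D ∘L T ≤ D) (hT : 1 ≤ adjoint T ∘L T) :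
    ∃ A : H →L[ℂ] H, D ≤ A ∧ A ≤ 1 ∧ adjoint T ∘L A ∘L T = A := by
  have hstep (A : Set.Icc D 1) : ∃ Y : Set.Icc D 1, adjoint T ∘L Y.1 ∘L T = A := by
    obtain ⟨Y, h1, h2, h3⟩ := exists_le_conj_eq hD1 hTD hT A.2.1 A.2.2
    exact ⟨⟨Y, h1, h2⟩, h3⟩
  choose g hg using hstep
  -- the backward orbit of `D`
  let a : ℕ → H →L[ℂ] H := fun n => (g^[n] ⟨D, le_rfl, hD1⟩).1
  have ha (n : ℕ) : a n ∈ Set.Icc D 1 := (g^[n] ⟨D, le_rfl, hD1⟩).2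
  have haT (n : ℕ) : adjoint T ∘L a (n + 1) ∘L T = a n := by
    change adjoint T ∘L (g^[n + 1] ⟨D, le_rfl, hD1⟩).1 ∘L T = _
    rw [Function.iterate_succ_apply']
    exact hg _
  have ha0 (n : ℕ) : 0 ≤ a n := hD0.trans (ha n).1
  have hnorm (n : ℕ) : ‖a n‖ ≤ 1 := norm_le_of_reApplyInnerSelf_le (ha0 n) zero_le_one fun x => by
    rw [one_mul, ← reApplyInnerSelf_one]
    exact (le_iff_reApplyInnerSelf (ha0 n).isSelfAdjoint (IsSelfAdjoint.one _)).1 (ha n).2 x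
  let S : ℕ → H →L[ℂ] H := fun n => ((n + 1 : ℝ)⁻¹) • ∑ k ∈ Finset.range (n + 1), a (k + 1)
  have hS (n : ℕ) : S n ∈ Set.Icc D 1 := by
    have := (convex_Icc (𝕜 := ℝ) D 1).sum_mem (t := Finset.range (n + 1))
      (w := fun _ => (n + 1 : ℝ)⁻¹) (z := fun k => a (k + 1)) (fun _ _ => by positivity)
      (by simp; field_simp) fun k _ => ha _
    simpa [S, Finset.smul_sum] using this
  have hS0 (n : ℕ) : 0 ≤ S n := hD0.trans (hS n).1
  have hST (n : ℕ) : adjoint T ∘L S n ∘L T = S n + ((n + 1 : ℝ)⁻¹) • (a 0 - a (n + 1)) := by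
    have : adjoint T ∘L S n ∘L T = ((n + 1 : ℝ)⁻¹) • ∑ k ∈ Finset.range (n + 1), a k := by
      rw [← Finset.sum_congr rfl fun k _ => haT k]
      ext x
      simp [S, sum_apply, map_sum]
    rw [this, ← smul_add, Finset.sum_range_succ' a, Finset.sum_range_succ (fun k => a (k + 1))]
    congr 1
    abel
  have hnormS (n : ℕ) : ‖S n‖ ≤ 1 := norm_le_of_reApplyInnerSelf_le (hS0 n) zero_le_one fun x => by
    rw [one_mul, ← reApplyInnerSelf_one]
    exact (le_iff_reApplyInnerSelf (hS0 n).isSelfAdjoint (IsSelfAdjoint.one _)).1 (hS n).2 x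
  obtain ⟨A, hA⟩ := exists_weak_limit (hyperfilter ℕ) S hnormS
  have hre (x : H) : Tendsto (fun n => (S n).reApplyInnerSelf x) (hyperfilter ℕ)
      (𝓝 (A.reApplyInnerSelf x)) :=
    (Complex.continuous_re.tendsto _).comp (hA x x)
  have hAsa : IsSelfAdjoint A := by
    rw [isSelfAdjoint_iff_isSymmetric]
    intro x y
    refine tendsto_nhds_unique (hA x y) ?_
    have := ((Complex.continuous_conj.tendsto _).comp (hA y x))
    simp only [Function.comp_def, inner_conj_symm] at this
    refine this.congr fun n => ?_
    exact ((isSelfAdjoint_iff_isSymmetric.1 (hS0 n).isSelfAdjoint) x y).symm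
  refine ⟨A, ?_, ?_, ?_⟩
  · rw [le_iff_reApplyInnerSelf hD0.isSelfAdjoint hAsa]
    exact fun x => ge_of_tendsto (hre x) (Eventually.of_forall fun n =>
      (le_iff_reApplyInnerSelf hD0.isSelfAdjoint (hS0 n).isSelfAdjoint).1 (hS n).1 x)
  · rw [le_iff_reApplyInnerSelf hAsa (IsSelfAdjoint.one _)]
    exact fun x => le_of_tendsto (hre x) (Eventually.of_forall fun n =>
      (le_iff_reApplyInnerSelf (hS0 n).isSelfAdjoint (IsSelfAdjoint.one _)).1 (hS n).2 x)
  · refine eq_of_reApplyInnerSelf_eq (hAsa.adjoint_conj T) hAsa fun x => ?_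
    rw [reApplyInnerSelf_conj]
    refine tendsto_nhds_unique (hre (T x)) ?_
    have h0 : Tendsto (fun n : ℕ => ((n + 1 : ℝ)⁻¹) * (a 0 - a (n + 1)).reApplyInnerSelf x)
        atTop (𝓝 0) := by
      have hz : Tendsto (fun n : ℕ => ((n + 1 : ℝ)⁻¹)) atTop (𝓝 0) := by
        simpa using tendsto_one_div_add_atTop_nhds_zero_nat (𝕜 := ℝ)
      refine hz.zero_mul_isBoundedUnder_le ?_
      refine ⟨‖x‖ ^ 2, eventually_map.2 (Eventually.of_forall fun n => ?_)⟩
      have h1 := (nonneg_iff_reApplyInnerSelf (ha0 0).isSelfAdjoint).1 (ha0 0) x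
      have h2 := (nonneg_iff_reApplyInnerSelf (ha0 (n+1)).isSelfAdjoint).1 (ha0 (n+1)) x
      have h3 := reApplyInnerSelf_le (a 0) x
      have h4 := reApplyInnerSelf_le (a (n + 1)) x
      have h5 := mul_le_of_le_one_left (sq_nonneg ‖x‖) (hnorm 0)
      have h6 := mul_le_of_le_one_left (sq_nonneg ‖x‖) (hnorm (n + 1))
      simp only [Function.comp_apply, reApplyInnerSelf_sub, Real.norm_eq_abs]
      exact abs_le.2 ⟨by linarith, by linarith⟩
    have := (hre x).add (h0.mono_left Nat.hyperfilter_le_atTop)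
    rw [add_zero] at this
    refine this.congr fun n => ?_
    rw [← reApplyInnerSelf_conj, hST, reApplyInnerSelf_add, reApplyInnerSelf_smul _ (a 0 - _)]

end Invariant

/-! ### A shift with prescribed wandering space -/

section Shift

/-- Every Hilbert space `G` is, isometrically, orthogonal to the range of an isometry `s`: a shift
on `ℓ²(ℕ, G)`. -/
theorem exists_shift (G : Type u) [NormedAddCommGroup G] [InnerProductSpace ℂ G]
    [CompleteSpace G] :
    ∃ (N : Type u) (_ : NormedAddCommGroup N) (_ : InnerProductSpace ℂ N) (_ : CompleteSpace N)
      (σ : G →L[ℂ] N) (s : N →L[ℂ] N), ∀ g n, ‖σ g + s n‖ ^ 2 = ‖g‖ ^ 2 + ‖n‖ ^ 2 := by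
  have key (f : lp (fun _ : ℕ => G) 2) : HasSum (fun k => ‖f k‖ ^ 2) (‖f‖ ^ 2) := by
    simpa using lp.hasSum_norm (p := 2) (by simp) f
  have hmem (g : G) (f : lp (fun _ : ℕ => G) 2) :
      Memℓp (fun k : ℕ => (k.casesOn g f : G)) 2 := by
    refine memℓp_gen ?_
    simp only [ENNReal.toReal_ofNat, Real.rpow_ofNat]
    exact (summable_nat_add_iff 1).1 (key f).summable
  let c : G → lp (fun _ : ℕ => G) 2 → lp (fun _ : ℕ => G) 2 := fun g f => ⟨_, hmem g f⟩
  have hc (g : G) (f) : ‖c g f‖ ^ 2 = ‖g‖ ^ 2 + ‖f‖ ^ 2 := by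
    refine (key (c g f)).unique ?_
    rw [add_comm]
    exact (hasSum_nat_add_iff' 1).1 (by simpa [c] using key f)
  have hadd (g g' : G) (f f') : c (g + g') (f + f') = c g f + c g' f' := by
    ext k; cases k <;> rfl
  have hsmul (r : ℂ) (g : G) (f) : c (r • g) (r • f) = r • c g f := by
    ext k; cases k <;> rfl
  let σ : G →ₗᵢ[ℂ] lp (fun _ : ℕ => G) 2 :=
    { toFun := fun g => c g 0
      map_add' := fun g g' => by rw [← hadd, add_zero]
      map_smul' := fun r g => by rw [RingHom.id_apply, ← hsmul, smul_zero]
      norm_map' := fun g => by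
        change ‖c g 0‖ = _
        rw [← sq_eq_sq₀ (norm_nonneg _) (norm_nonneg _), hc]; simp }
  let s : lp (fun _ : ℕ => G) 2 →ₗᵢ[ℂ] lp (fun _ : ℕ => G) 2 :=
    { toFun := fun f => c 0 f
      map_add' := fun g g' => by rw [← hadd, add_zero]
      map_smul' := fun r g => by rw [RingHom.id_apply, ← hsmul, smul_zero]
      norm_map' := fun f => by
        change ‖c 0 f‖ = _
        rw [← sq_eq_sq₀ (norm_nonneg _) (norm_nonneg _), hc]; simp }
  refine ⟨lp (fun _ : ℕ => G) 2, inferInstance, inferInstance, inferInstance,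
    σ.toContinuousLinearMap, s.toContinuousLinearMap, fun g f => ?_⟩
  change ‖c g 0 + c 0 f‖ ^ 2 = _
  rw [← hadd, add_zero, zero_add, hc]

end Shift

/-! ### Growth of powers of a concave operator -/

section Growth

variable {H : Type*} [NormedAddCommGroup H] [InnerProductSpace ℂ H]

theorem pow_succ_apply (T : H →L[ℂ] H) (n : ℕ) (x : H) : (T ^ (n + 1)) x = T ((T ^ n) x) := by
  rw [pow_succ']
  rfl

variable [CompleteSpace H]

theorem cov_nonneg (T : H →L[ℂ] H) : 0 ≤ cov T := Real.sqrt_nonneg _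

/-- For concave `T` the squared norm of `Δ_T^{1/2} Tⁿ x` is an increment of `‖Tⁿ x‖²`. -/
theorem deltaStable_iff {T : H →L[ℂ] H} (hT : IsConcave T) :
    DeltaStable T ↔
      ∀ x, Tendsto (fun n : ℕ => ‖(T ^ (n + 1)) x‖ ^ 2 - ‖(T ^ n) x‖ ^ 2) atTop (𝓝 0) := by
  refine forall_congr' fun x => ?_
  have h (n : ℕ) : ‖CFC.sqrt (Delta T) ((T ^ n) x)‖ ^ 2
      = ‖(T ^ (n + 1)) x‖ ^ 2 - ‖(T ^ n) x‖ ^ 2 := by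
    rw [norm_sqrt_apply_sq hT.delta_nonneg, re_inner_delta, pow_succ_apply]
  simp_rw [← h]
  rw [tendsto_zero_iff_norm_tendsto_zero]
  refine ⟨fun h => by simpa using h.pow 2, fun h => ?_⟩
  have := (Real.continuous_sqrt.tendsto _).comp h
  simpa [Function.comp_def] using this

/-- The squared norm `‖Tⁿx‖²` telescopes into the increments `‖Tᵏ⁺¹x‖² - ‖Tᵏx‖²`, whose Cesàro
means tend to zero with them. -/
theorem DeltaStable.rootPowersTendToZero {T : H →L[ℂ] H} (hT : IsConcave T)
    (h : DeltaStable T) : RootPowersTendToZero T := by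
  intro x
  have h1 := ((deltaStable_iff hT).1 h x).cesaro
  simp_rw [Finset.sum_range_sub (fun n => ‖(T ^ n) x‖ ^ 2)] at h1
  have h2 : Tendsto (fun n : ℕ => (n : ℝ)⁻¹ * ‖x‖ ^ 2) atTop (𝓝 0) := by
    simpa using tendsto_inv_atTop_nhds_zero_nat.mul_const (b := ‖x‖ ^ 2)
  have h3 := (Real.continuous_sqrt.tendsto _).comp (h1.add h2)
  rw [tendsto_zero_iff_norm_tendsto_zero]
  simp only [add_zero, Real.sqrt_zero] at h3
  refine h3.congr fun n => ?_
  have : (n : ℝ)⁻¹ * (‖(T ^ n) x‖ ^ 2 - ‖(T ^ 0) x‖ ^ 2) + (n : ℝ)⁻¹ * ‖x‖ ^ 2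
      = (n : ℝ)⁻¹ * ‖(T ^ n) x‖ ^ 2 := by
    rw [pow_zero, show (1 : H →L[ℂ] H) x = x from rfl]; ring
  rw [Function.comp_apply, this, Real.sqrt_mul (by positivity), Real.sqrt_sq (norm_nonneg _),
    norm_smul, Complex.norm_real, Real.norm_of_nonneg (by positivity), Real.sqrt_inv]

theorem cov_sq (T : H →L[ℂ] H) : cov T ^ 2 = ‖Delta T‖ := Real.sq_sqrt (norm_nonneg _)

end Growth

/-! ### Properties shared by all model extensions -/

section Model

variable {H : Type u} [NormedAddCommGroup H] [InnerProductSpace ℂ H] [CompleteSpace H]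
  {M₀ M₁ : Type v} [NormedAddCommGroup M₀] [InnerProductSpace ℂ M₀]
  [NormedAddCommGroup M₁] [InnerProductSpace ℂ M₁]
  {T : H →L[ℂ] H} {V : M₀ →L[ℂ] M₀} {E₁ : M₁ →L[ℂ] M₀} {W : M₁ →L[ℂ] M₁}
  {Z : H →ₗᵢ[ℂ] WithLp 2 (M₀ × M₁)}

theorem snd_model_pow (n : ℕ) (m : WithLp 2 (M₀ × M₁)) :
    ((model T V E₁ W ^ n) m).snd = (W ^ n) m.snd := by
  induction n with
  | zero => rfl
  | succ n ih =>
    rw [pow_succ_apply, pow_succ_apply, ← ih]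
    rfl

variable [CompleteSpace M₀] [CompleteSpace M₁]

namespace IsModelExtension

/-- The defect `‖T₁ m‖² - ‖m‖²` depends only on the second component of `m`: this identity carries
all the properties of model extensions. -/
theorem norm_sq_model (h : IsModelExtension T V E₁ W Z) (m : WithLp 2 (M₀ × M₁)) :
    ‖model T V E₁ W m‖ ^ 2 = ‖m‖ ^ 2 + cov T ^ 2 * ‖E₁ m.snd‖ ^ 2 := by
  have hV := (norm_map_iff_adjoint_comp_self V).2 h.isometry_V
  have hW := (norm_map_iff_adjoint_comp_self W).2 h.isometry_W
  have horth : ⟪V m.fst, ((cov T : ℝ) : ℂ) • E₁ m.snd⟫_ℂ = 0 := by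
    have : adjoint V (E₁ m.snd) = 0 := congrArg (fun S => S m.snd) h.orthogonal
    rw [inner_smul_right, ← adjoint_inner_right, this, inner_zero_right, mul_zero]
  have h1 : (model T V E₁ W m).fst = V m.fst + ((cov T : ℝ) : ℂ) • E₁ m.snd := rfl
  have h2 : (model T V E₁ W m).snd = W m.snd := rfl
  rw [WithLp.prod_norm_sq_eq_of_L2, WithLp.prod_norm_sq_eq_of_L2, h1, h2, hW,
    norm_add_sq (𝕜 := ℂ), horth, hV, norm_smul, Complex.norm_real, mul_pow, Real.norm_eq_abs,
    sq_abs]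
  simp only [map_zero]
  ring

theorem norm_E₁_W_le (h : IsModelExtension T V E₁ W Z) (y : M₁) : ‖E₁ (W y)‖ ≤ ‖E₁ y‖ := by
  have h1 : adjoint W ∘L adjoint E₁ ∘L E₁ ∘L W = adjoint (E₁ ∘L W) ∘L (E₁ ∘L W) := by
    rw [adjoint_comp]; rfl
  have h2 := h.le
  rw [h1, le_iff_reApplyInnerSelf (isPositive_adjoint_comp_self _).isSelfAdjoint
    (isPositive_adjoint_comp_self _).isSelfAdjoint] at h2
  have h3 := h2 y
  rw [reApplyInnerSelf_adjoint_comp_self, reApplyInnerSelf_adjoint_comp_self] at h3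
  exact (sq_le_sq₀ (norm_nonneg _) (norm_nonneg _)).1 h3

theorem norm_E₁_le (h : IsModelExtension T V E₁ W Z) (y : M₁) : ‖E₁ y‖ ≤ ‖y‖ := by
  simpa using E₁.le_of_opNorm_le h.contraction y

theorem isConcave_model (h : IsModelExtension T V E₁ W Z) : IsConcave (model T V E₁ W) := by
  intro m
  have h1 := h.norm_sq_model m
  have h2 := h.norm_sq_model (model T V E₁ W m)
  have h3 : ‖E₁ (model T V E₁ W m).snd‖ ^ 2 ≤ ‖E₁ m.snd‖ ^ 2 := by
    gcongr
    exact h.norm_E₁_W_le m.snd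
  have h4 := mul_le_mul_of_nonneg_left h3 (sq_nonneg (cov T))
  linarith

theorem map_pow (h : IsModelExtension T V E₁ W Z) (n : ℕ) (x : H) :
    Z ((T ^ n) x) = (model T V E₁ W ^ n) (Z x) := by
  induction n with
  | zero => rfl
  | succ n ih =>
    rw [pow_succ_apply, pow_succ_apply, h.intertwines, ih]

theorem isConcave (h : IsModelExtension T V E₁ W Z) : IsConcave T := by
  intro x
  rw [← Z.norm_map x, ← Z.norm_map (T x), ← Z.norm_map (T (T x)), h.intertwines, h.intertwines]
  exact h.isConcave_model (Z x)

theorem cov_model (h : IsModelExtension T V E₁ W Z) : cov (model T V E₁ W) = cov T := by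
  refine congrArg Real.sqrt (le_antisymm ?_ ?_)
  · refine norm_le_of_reApplyInnerSelf_le h.isConcave_model.delta_nonneg (norm_nonneg _)
      fun m => ?_
    rw [re_inner_delta, h.norm_sq_model, cov_sq, add_sub_cancel_left]
    gcongr
    refine (h.norm_E₁_le _).trans ?_
    rw [← sq_le_sq₀ (norm_nonneg _) (norm_nonneg _), WithLp.prod_norm_sq_eq_of_L2 m]
    linarith [sq_nonneg ‖m.fst‖]
  · refine norm_le_of_reApplyInnerSelf_le h.isConcave.delta_nonneg (norm_nonneg _) fun x => ?_
    have := reApplyInnerSelf_le (Delta (model T V E₁ W)) (Z x)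
    rwa [re_inner_delta, ← h.intertwines, Z.norm_map, Z.norm_map, ← re_inner_delta] at this

theorem deltaStable (h : IsModelExtension T V E₁ W Z)
    (hs : DeltaStable (model T V E₁ W)) : DeltaStable T := by
  rw [deltaStable_iff h.isConcave]
  intro x
  have := (deltaStable_iff h.isConcave_model).1 hs (Z x)
  simpa only [← h.map_pow, Z.norm_map] using this

theorem norm_sq_pow_succ_sub (h : IsModelExtension T V E₁ W Z) (n : ℕ) (m : WithLp 2 (M₀ × M₁)) :
    ‖(model T V E₁ W ^ (n + 1)) m‖ ^ 2 - ‖(model T V E₁ W ^ n) m‖ ^ 2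
      = ‖((cov T : ℝ) : ℂ) • E₁ ((W ^ n) m.snd)‖ ^ 2 := by
  rw [pow_succ_apply, h.norm_sq_model, snd_model_pow, norm_smul,
    Complex.norm_real, mul_pow, Real.norm_eq_abs, sq_abs]
  ring

/-- The vectors `y` with `δ E₁ Wⁿ y → 0` form a closed set since the operators `δ E₁ Wⁿ` are
uniformly bounded; for a stable `T` this set contains the dense set `P Z H`. -/
theorem deltaStable_model (h : IsModelExtension T V E₁ W Z) (ht : IsTight Z)
    (hs : DeltaStable T) : DeltaStable (model T V E₁ W) := by
  have hW := (norm_map_iff_adjoint_comp_self W).2 h.isometry_W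
  have hWn (n : ℕ) (y : M₁) : ‖(W ^ n) y‖ = ‖y‖ := by
    induction n with
    | zero => rfl
    | succ n ih => rw [pow_succ_apply, hW, ih]
  let L : ℕ → M₁ →L[ℂ] M₀ := fun n => ((cov T : ℝ) : ℂ) • (E₁ ∘L W ^ n)
  have hLn (n : ℕ) (y : M₁) : ‖L n y‖ ≤ cov T * ‖y‖ := by
    have h1 : ‖L n y‖ = cov T * ‖E₁ ((W ^ n) y)‖ := by
      change ‖((cov T : ℝ) : ℂ) • E₁ ((W ^ n) y)‖ = _
      rw [norm_smul, Complex.norm_real, Real.norm_of_nonneg (cov_nonneg T)]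
    rw [h1]
    gcongr
    · exact cov_nonneg T
    · exact (h.norm_E₁_le _).trans (hWn n y).le
  have hinc (n : ℕ) (m : WithLp 2 (M₀ × M₁)) : ‖(model T V E₁ W ^ (n + 1)) m‖ ^ 2
      - ‖(model T V E₁ W ^ n) m‖ ^ 2 = ‖L n m.snd‖ ^ 2 := h.norm_sq_pow_succ_sub n m
  have hZ (x : H) : Tendsto (fun n => L n (Z x).snd) atTop (𝓝 0) := by
    have h1 := (deltaStable_iff h.isConcave).1 hs x
    simp only [← Z.norm_map, h.map_pow, hinc] at h1
    rw [tendsto_zero_iff_norm_tendsto_zero]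
    simpa [Function.comp_def] using (Real.continuous_sqrt.tendsto _).comp h1
  have hall (y : M₁) : Tendsto (fun n => L n y) atTop (𝓝 0) := by
    rw [Metric.tendsto_atTop]
    intro ε hε
    have hc : 0 < cov T + 1 := add_pos_of_nonneg_of_pos (cov_nonneg T) one_pos
    obtain ⟨x, hx⟩ := ht.exists_dist_lt y (ε := ε / 2 / (cov T + 1)) (by positivity)
    obtain ⟨N, hN⟩ := Metric.tendsto_atTop.1 (hZ x) (ε / 2) (by positivity)
    refine ⟨N, fun n hn => ?_⟩
    have h1 := hN n hn
    rw [dist_zero_right] at h1 ⊢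
    have h2 : ‖L n (y - (Z x).snd)‖ ≤ ε / 2 := by
      refine (hLn n _).trans ?_
      rw [dist_eq_norm, lt_div_iff₀ hc] at hx
      nlinarith [norm_nonneg (y - (Z x).snd)]
    have h3 : L n y = L n (y - (Z x).snd) + L n (Z x).snd := by rw [map_sub, sub_add_cancel]
    rw [h3]
    linarith [norm_add_le (L n (y - (Z x).snd)) (L n (Z x).snd)]
  rw [deltaStable_iff h.isConcave_model]
  intro m
  simp only [hinc]
  simpa using (hall m.snd).norm.pow 2

end IsModelExtension

end Model

/-! ### Existence of a tight model extension -/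

section Existence

/-- The column operator `x ↦ (f x, g x)` into the Hilbert space direct sum. -/
def column {E F G : Type*} [NormedAddCommGroup E] [NormedSpace ℂ E] [NormedAddCommGroup F]
    [NormedSpace ℂ F] [NormedAddCommGroup G] [NormedSpace ℂ G] (f : E →L[ℂ] F) (g : E →L[ℂ] G) :
    E →L[ℂ] WithLp 2 (F × G) :=
  ((WithLp.prodContinuousLinearEquiv 2 ℂ F G).symm : (F × G) →L[ℂ] WithLp 2 (F × G)) ∘L f.prod g

theorem norm_sq_column {E F G : Type*} [NormedAddCommGroup E] [NormedSpace ℂ E]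
    [NormedAddCommGroup F] [NormedSpace ℂ F] [NormedAddCommGroup G] [NormedSpace ℂ G]
    (f : E →L[ℂ] F) (g : E →L[ℂ] G) (x : E) :
    ‖column f g x‖ ^ 2 = ‖f x‖ ^ 2 + ‖g x‖ ^ 2 :=
  WithLp.prod_norm_sq_eq_of_L2 _

variable {H : Type u} [NormedAddCommGroup H] [InnerProductSpace ℂ H] [CompleteSpace H]

/-- The defect operator `d = (I - F* F)^{1/2}` of a contraction `F`. -/
theorem exists_defect {F : Type*} [NormedAddCommGroup F] [InnerProductSpace ℂ F] [CompleteSpace F]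
    (C : H →L[ℂ] F) (hC : ‖C‖ ≤ 1) :
    ∃ d : H →L[ℂ] H, ∀ w, ‖C w‖ ^ 2 + ‖d w‖ ^ 2 = ‖w‖ ^ 2 := by
  have hCC : 0 ≤ 1 - adjoint C ∘L C := by
    rw [nonneg_iff_reApplyInnerSelf
      ((IsSelfAdjoint.one _).sub (isPositive_adjoint_comp_self C).isSelfAdjoint)]
    intro w
    rw [reApplyInnerSelf_sub, reApplyInnerSelf_one, reApplyInnerSelf_adjoint_comp_self, sub_nonneg]
    gcongr
    simpa using C.le_of_opNorm_le hC w
  refine ⟨CFC.sqrt (1 - adjoint C ∘L C), fun w => ?_⟩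
  rw [norm_sqrt_apply_sq hCC, reApplyInnerSelf_sub, reApplyInnerSelf_one,
    reApplyInnerSelf_adjoint_comp_self]
  ring

/-- If `‖b T x‖² = ‖b x‖² + ‖q x‖²`, then the isometric correspondence `(b x, q x) ↦ b T x` extends
to an isometry `(V U)` from `M₀ ⊕ H` to `M₀` on a Hilbert space `M₀` containing `H`. The
correspondence is extended to a contraction `F` on `H ⊕ H`, whose defect is then recorded in the
first coordinate of a shift, as in Schäffer's dilation. -/
theorem exists_row_isometry (T b q : H →L[ℂ] H)
    (h : ∀ x, ‖b (T x)‖ ^ 2 = ‖b x‖ ^ 2 + ‖q x‖ ^ 2) :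
    ∃ (M₀ : Type u) (_ : NormedAddCommGroup M₀) (_ : InnerProductSpace ℂ M₀) (_ : CompleteSpace M₀)
      (ι : H →L[ℂ] M₀) (V : M₀ →L[ℂ] M₀) (U : H →L[ℂ] M₀),
      (∀ x, ‖ι x‖ = ‖x‖) ∧ (∀ m k, ‖V m + U k‖ ^ 2 = ‖m‖ ^ 2 + ‖k‖ ^ 2) ∧
      ∀ x, ι (b (T x)) = V (ι (b x)) + U (q x) := by
  have hcol (x : H) : ‖(b ∘L T) x‖ ^ 2 = ‖column b q x‖ ^ 2 := by
    rw [norm_sq_column]; exact h x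
  obtain ⟨F, hF, hFx⟩ := exists_contraction_comp_eq (column b q) (b ∘L T) fun x =>
    ((sq_le_sq₀ (norm_nonneg _) (norm_nonneg _)).1 (hcol x).le)
  obtain ⟨d, hd⟩ := exists_defect F hF
  have hd0 (x : H) : d (column b q x) = 0 := by
    have h1 := hd (column b q x)
    rw [hFx, hcol] at h1
    simpa using h1
  obtain ⟨N, _, _, _, σ, s, hσ⟩ := exists_shift (WithLp 2 (H × H))
  let p₁ : H →L[ℂ] WithLp 2 (H × H) := column (1 : H →L[ℂ] H) (0 : H →L[ℂ] H)
  let p₂ : H →L[ℂ] WithLp 2 (H × H) := column (0 : H →L[ℂ] H) (1 : H →L[ℂ] H)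
  have hp (x y : H) : p₁ x + p₂ y = WithLp.toLp 2 (x, y) := by
    change WithLp.toLp 2 (x + 0, 0 + y) = _
    simp
  let V : WithLp 2 (H × N) →L[ℂ] WithLp 2 (H × N) :=
    column (F ∘L p₁ ∘L WithLp.fstL 2 ℂ H N)
      (σ ∘L d ∘L p₁ ∘L WithLp.fstL 2 ℂ H N + s ∘L WithLp.sndL 2 ℂ H N)
  let U : H →L[ℂ] WithLp 2 (H × N) := column (F ∘L p₂) (σ ∘L d ∘L p₂)
  have hVU (m : WithLp 2 (H × N)) (k : H) : V m + U k = WithLp.toLp 2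
      (F (WithLp.toLp 2 (m.fst, k)), σ (d (WithLp.toLp 2 (m.fst, k))) + s m.snd) := by
    change WithLp.toLp 2 (F (p₁ m.fst) + F (p₂ k),
      σ (d (p₁ m.fst)) + s m.snd + σ (d (p₂ k))) = _
    rw [← hp, map_add, map_add, map_add, add_right_comm]
  refine ⟨WithLp 2 (H × N), inferInstance, inferInstance, inferInstance,
    column (1 : H →L[ℂ] H) (0 : H →L[ℂ] N), V, U, fun x => ?_, fun m k => ?_, fun x => ?_⟩
  · rw [← sq_eq_sq₀ (norm_nonneg _) (norm_nonneg _), norm_sq_column]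
    simp
  · rw [hVU, WithLp.prod_norm_sq_eq_of_L2]
    change ‖F _‖ ^ 2 + ‖σ _ + s _‖ ^ 2 = _
    rw [hσ, ← add_assoc, hd, WithLp.prod_norm_sq_eq_of_L2, WithLp.prod_norm_sq_eq_of_L2 m]
    simp only [WithLp.fst, WithLp.snd]
    ring
  · rw [hVU]
    change WithLp.toLp 2 (b (T x), (0 : N)) =
      WithLp.toLp 2 (F (column b q x), σ (d (column b q x)) + s 0)
    -- `F` is isometric on the vectors `(b x, q x)`, so their defect vanishes
    rw [hd0, hFx, map_zero, map_zero, add_zero]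
    rfl

theorem IsConcave.conj_delta_le {T : H →L[ℂ] H} (hT : IsConcave T) :
    adjoint T ∘L Delta T ∘L T ≤ Delta T := by
  rw [le_iff_reApplyInnerSelf ((isSelfAdjoint_Delta T).adjoint_conj T) (isSelfAdjoint_Delta T)]
  intro x
  rw [reApplyInnerSelf_conj, re_inner_delta, re_inner_delta]
  linarith [hT x]

/-- For concave `T` there is a `T`-invariant form `A` with `Δ_T ≤ ‖Δ_T‖ A` and `A ≤ I`. The
operator `D` is the normalization `Δ_T / ‖Δ_T‖`. -/
theorem IsConcave.exists_invariant {T : H →L[ℂ] H} (hT : IsConcave T) :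
    ∃ D A : H →L[ℂ] H, 0 ≤ D ∧ D ≤ A ∧ A ≤ 1 ∧ adjoint T ∘L A ∘L T = A ∧
      adjoint T ∘L D ∘L T ≤ D ∧ Delta T = ‖Delta T‖ • D := by
  have hΔ := hT.delta_nonneg
  -- if `‖Δ_T‖ = 0`, then `‖Δ_T‖⁻¹ = 0` as well and both sides vanish
  have hD : Delta T = ‖Delta T‖ • (‖Delta T‖⁻¹ • Delta T) := by
    by_cases h0 : ‖Delta T‖ = 0
    · rw [h0, zero_smul]; exact norm_eq_zero.1 h0
    · rw [smul_inv_smul₀ h0]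
  have hsa : IsSelfAdjoint (‖Delta T‖⁻¹ • Delta T) :=
    (IsSelfAdjoint.all _).smul (isSelfAdjoint_Delta T)
  have hD0 : 0 ≤ ‖Delta T‖⁻¹ • Delta T := by
    rw [nonneg_iff_reApplyInnerSelf hsa]
    intro x
    rw [reApplyInnerSelf_smul]
    exact mul_nonneg (by positivity)
      ((nonneg_iff_reApplyInnerSelf (isSelfAdjoint_Delta T)).1 hΔ x)
  have hD1 : ‖Delta T‖⁻¹ • Delta T ≤ 1 := by
    rw [le_iff_reApplyInnerSelf hsa (IsSelfAdjoint.one _)]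
    intro x
    rw [reApplyInnerSelf_smul, reApplyInnerSelf_one]
    calc _ ≤ ‖Delta T‖⁻¹ * (‖Delta T‖ * ‖x‖ ^ 2) := by
          gcongr; exact reApplyInnerSelf_le _ x
      _ = (‖Delta T‖⁻¹ * ‖Delta T‖) * ‖x‖ ^ 2 := by ring
      _ ≤ 1 * ‖x‖ ^ 2 := by gcongr; exact inv_mul_le_one
      _ = _ := one_mul _
  have hTD : adjoint T ∘L (‖Delta T‖⁻¹ • Delta T) ∘L T ≤ ‖Delta T‖⁻¹ • Delta T := by
    rw [le_iff_reApplyInnerSelf (hsa.adjoint_conj T) hsa]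
    intro x
    rw [reApplyInnerSelf_conj, reApplyInnerSelf_smul, reApplyInnerSelf_smul,
      ← reApplyInnerSelf_conj]
    gcongr
    exact (le_iff_reApplyInnerSelf ((isSelfAdjoint_Delta T).adjoint_conj T)
      (isSelfAdjoint_Delta T)).1 hT.conj_delta_le x
  obtain ⟨A, h1, h2, h3⟩ := ConcaveOp.exists_invariant hD0 hD1 hTD (sub_nonneg.1 hΔ)
  exact ⟨_, A, hD0, h1, h2, h3, hTD, hD⟩

/-- With the invariant form `A` between `D = Δ_T / ‖Δ_T‖` and `I`, the second component of `Z` is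
`A^{1/2}`, on which `T` acts isometrically, and the first one is `(I - A)^{1/2}`, placed in the space
of a row isometry `(V U)`. Since `D ≤ A`, the operator `D^{1/2}` factors through `A^{1/2}` by a
contraction `G`, and `E₁ = U G`. -/
theorem IsConcave.exists_tight_model {T : H →L[ℂ] H} (hT : IsConcave T) :
    ∃ (M₀ M₁ : Type u) (_ : NormedAddCommGroup M₀) (_ : InnerProductSpace ℂ M₀)
      (_ : CompleteSpace M₀) (_ : NormedAddCommGroup M₁) (_ : InnerProductSpace ℂ M₁)
      (_ : CompleteSpace M₁)
      (V : M₀ →L[ℂ] M₀) (E₁ : M₁ →L[ℂ] M₀) (W : M₁ →L[ℂ] M₁)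
      (Z : H →ₗᵢ[ℂ] WithLp 2 (M₀ × M₁)),
      IsModelExtension T V E₁ W Z ∧ IsTight Z := by
  obtain ⟨D, A, hD0, hDA, hA1, hTA, hTD, hΔ⟩ := hT.exists_invariant
  have hA0 : 0 ≤ A := hD0.trans hDA
  have hB0 : 0 ≤ 1 - A := sub_nonneg.2 hA1
  have hDsa := hD0.isSelfAdjoint
  set Q := CFC.sqrt D
  set a := CFC.sqrt A
  set b := CFC.sqrt (1 - A)
  have hQ (x) : ‖Q x‖ ^ 2 = D.reApplyInnerSelf x := norm_sqrt_apply_sq hD0 x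
  have ha (x) : ‖a x‖ ^ 2 = A.reApplyInnerSelf x := norm_sqrt_apply_sq hA0 x
  have hb (x) : ‖b x‖ ^ 2 = ‖x‖ ^ 2 - A.reApplyInnerSelf x := by
    rw [norm_sqrt_apply_sq hB0, reApplyInnerSelf_sub, reApplyInnerSelf_one]
  have hT2 (x) : ‖T x‖ ^ 2 = ‖x‖ ^ 2 + cov T ^ 2 * ‖Q x‖ ^ 2 := by
    rw [hQ, cov_sq, ← reApplyInnerSelf_smul, ← hΔ, re_inner_delta]
    ring
  have hAT (x) : A.reApplyInnerSelf (T x) = A.reApplyInnerSelf x := by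
    rw [← reApplyInnerSelf_conj, hTA]
  have hQa (x) : ‖Q x‖ ≤ ‖a x‖ := by
    rw [← sq_le_sq₀ (norm_nonneg _) (norm_nonneg _), hQ, ha]
    exact (le_iff_reApplyInnerSelf hDsa hA0.isSelfAdjoint).1 hDA x
  have hQT (x) : ‖Q (T x)‖ ≤ ‖Q x‖ := by
    rw [← sq_le_sq₀ (norm_nonneg _) (norm_nonneg _), hQ, hQ, ← reApplyInnerSelf_conj]
    exact (le_iff_reApplyInnerSelf (hDsa.adjoint_conj T) hDsa).1 hTD x
  have haT (x) : ‖a (T x)‖ = ‖a x‖ := by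
    rw [← sq_eq_sq₀ (norm_nonneg _) (norm_nonneg _), ha, ha, hAT]
  obtain ⟨M₀, _, _, _, ι, V, U, hι, hVU, hint⟩ :=
    exists_row_isometry T b (((cov T : ℝ) : ℂ) • Q) fun x => by
      rw [smul_apply, norm_smul, Complex.norm_real, mul_pow, Real.norm_eq_abs, sq_abs, hb, hb,
        hAT, hT2]
      ring
  have hV (m) : ‖V m‖ = ‖m‖ := by
    simpa using hVU m 0
  have hU (k) : ‖U k‖ = ‖k‖ := by
    simpa using hVU 0 k
  have hVUorth (k : H) : adjoint V (U k) = 0 := by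
    -- additivity of the squared norms at `m = V* U k` gives `‖V* U k‖² = re ⟪V V* U k, U k⟫ = 0`
    have h1 := hVU (adjoint V (U k)) k
    rw [norm_add_sq (𝕜 := ℂ), hV, hU, ← adjoint_inner_right, inner_self_eq_norm_sq] at h1
    have h2 : ‖adjoint V (U k)‖ ^ 2 = 0 := by linarith
    simpa using h2
  let Z₁ := a.toRangeClosure
  have hZ₁ : DenseRange Z₁ := a.denseRange_toRangeClosure
  have hZ₁n (x) : ‖Z₁ x‖ = ‖a x‖ := rfl
  obtain ⟨W, -, hWx⟩ := exists_contraction_comp_eq Z₁ (Z₁ ∘L T) fun x => (haT x).le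
  obtain ⟨G, hG, hGx⟩ := exists_contraction_comp_eq Z₁ Q hQa
  have hW (y) : ‖W y‖ = ‖y‖ := by
    refine isClosed_property (p := fun y => ‖W y‖ = ‖y‖) hZ₁
      (isClosed_eq (by fun_prop) (by fun_prop)) (fun x => ?_) y
    rw [hWx]
    exact haT x
  have hGW (y) : ‖G (W y)‖ ≤ ‖G y‖ := by
    refine isClosed_property (p := fun y => ‖G (W y)‖ ≤ ‖G y‖) hZ₁
      (isClosed_le (by fun_prop) (by fun_prop)) (fun x => ?_) y
    rw [hWx, comp_apply, hGx, hGx]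
    exact hQT x
  let Z : H →ₗᵢ[ℂ] WithLp 2 (M₀ × a.range.topologicalClosure) :=
    { (column (ι ∘L b) Z₁).toLinearMap with
      norm_map' := fun x => by
        change ‖column (ι ∘L b) Z₁ x‖ = _
        rw [← sq_eq_sq₀ (norm_nonneg _) (norm_nonneg _), norm_sq_column, comp_apply, hι, hZ₁n,
          ha, hb]
        ring }
  refine ⟨M₀, a.range.topologicalClosure, inferInstance, inferInstance, inferInstance,
    inferInstance, inferInstance, inferInstance, V, U ∘L G, W, Z, ?_, hZ₁⟩
  refine ⟨(norm_map_iff_adjoint_comp_self V).1 hV, (norm_map_iff_adjoint_comp_self W).1 hW,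
    ?_, ?_, ?_, fun x => ?_⟩
  · refine opNorm_le_bound _ zero_le_one fun y => ?_
    rw [comp_apply, hU]
    exact G.le_of_opNorm_le hG y
  · ext y
    exact hVUorth (G y)
  · have h1 : adjoint W ∘L adjoint (U ∘L G) ∘L (U ∘L G) ∘L W
        = adjoint ((U ∘L G) ∘L W) ∘L ((U ∘L G) ∘L W) := by
      rw [adjoint_comp (U ∘L G) W]; rfl
    rw [h1, le_iff_reApplyInnerSelf (isPositive_adjoint_comp_self _).isSelfAdjoint
      (isPositive_adjoint_comp_self _).isSelfAdjoint]
    intro y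
    rw [reApplyInnerSelf_adjoint_comp_self, reApplyInnerSelf_adjoint_comp_self]
    simp only [comp_apply, hU]
    gcongr
    exact hGW y
  · change WithLp.toLp 2 (ι (b (T x)), Z₁ (T x)) =
      WithLp.toLp 2 (V (ι (b x)) + ((cov T : ℝ) : ℂ) • U (G (Z₁ x)), W (Z₁ x))
    rw [hint, hWx, hGx, smul_apply, map_smul]
    rfl

end Existence

/-! ### Minimal 2-isometric liftings of type I -/

section Lifting

theorem apply_eq_zero_of_reApplyInnerSelf_eq_zero {H : Type*} [NormedAddCommGroup H]
    [InnerProductSpace ℂ H] [CompleteSpace H] {P : H →L[ℂ] H} (hP : 0 ≤ P) {x : H}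
    (hx : P.reApplyInnerSelf x = 0) : P x = 0 := by
  have h1 : CFC.sqrt P x = 0 := by simpa [hx] using norm_sqrt_apply_sq hP x
  rw [← CFC.sqrt_mul_sqrt_self P hP]
  change CFC.sqrt P (CFC.sqrt P x) = 0
  rw [h1, map_zero]

theorem isTwoIsometry_iff {K : Type*} [NormedAddCommGroup K]
    [InnerProductSpace ℂ K] [CompleteSpace K] {S : K →L[ℂ] K} :
    IsTwoIsometry S ↔ ∀ y, ‖S (S y)‖ ^ 2 - ‖S y‖ ^ 2 = ‖S y‖ ^ 2 - ‖y‖ ^ 2 := by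
  simp_rw [← re_inner_delta, ← reApplyInnerSelf_conj]
  exact ⟨fun h y => by rw [h], fun h => eq_of_reApplyInnerSelf_eq
    ((isSelfAdjoint_Delta S).adjoint_conj S) (isSelfAdjoint_Delta S) h⟩

theorem IsTwoIsometry.isConcave {K : Type*} [NormedAddCommGroup K]
    [InnerProductSpace ℂ K] [CompleteSpace K] {S : K →L[ℂ] K} (hS : IsTwoIsometry S) :
    IsConcave S := fun y => by
  linarith [isTwoIsometry_iff.1 hS y]

variable {H : Type u} [NormedAddCommGroup H] [InnerProductSpace ℂ H] [CompleteSpace H]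

/-- The covariance can only grow under a lifting, since `‖T x‖ ≤ ‖S J x‖`. -/
theorem IsLifting.cov_le {K : Type v} [NormedAddCommGroup K] [InnerProductSpace ℂ K]
    [CompleteSpace K] {T : H →L[ℂ] H} {S : K →L[ℂ] K} {J : H →ₗᵢ[ℂ] K} (hT : IsConcave T)
    (h : IsLifting T S J) : cov T ≤ cov S := by
  refine Real.sqrt_le_sqrt (norm_le_of_reApplyInnerSelf_le hT.delta_nonneg (norm_nonneg _)
    fun x => ?_)
  have hJ : adjoint J.toContinuousLinearMap (J x) = x :=
    congrArg (fun R => R x) ((norm_map_iff_adjoint_comp_self J.toContinuousLinearMap).1 J.norm_map)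
  have h1 : T x = adjoint J.toContinuousLinearMap (S (J x)) := by
    have := congrArg (fun R => R (J x)) h
    simp only [comp_apply, hJ] at this
    exact this.symm
  have h2 : ‖T x‖ ≤ ‖S (J x)‖ := by
    rw [h1]
    refine (le_opNorm _ _).trans (mul_le_of_le_one_left (norm_nonneg _) ?_)
    rw [LinearIsometryEquiv.norm_map]
    exact J.norm_toContinuousLinearMap_le
  have h3 := reApplyInnerSelf_le (Delta S) (J x)
  rw [re_inner_delta, J.norm_map] at h3
  rw [re_inner_delta]
  have h4 : ‖T x‖ ^ 2 ≤ ‖S (J x)‖ ^ 2 := by gcongr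
  linarith

/-- A 2-isometric lifting of type I restricts to a minimal one on the closed linear span of the
spaces `Sⁿ J H`. -/
theorem exists_minimal_restriction {K : Type v} [NormedAddCommGroup K] [InnerProductSpace ℂ K]
    [CompleteSpace K] {T : H →L[ℂ] H} {S : K →L[ℂ] K} {J : H →ₗᵢ[ℂ] K} (hT : IsConcave T)
    (hL : IsLifting T S J) (hS : IsTwoIsometry S) (hI : IsTypeI S J) (hcov : cov S ≤ cov T) :
    ∃ (K' : Type v) (_ : NormedAddCommGroup K') (_ : InnerProductSpace ℂ K')
      (_ : CompleteSpace K') (S' : K' →L[ℂ] K') (J' : H →ₗᵢ[ℂ] K'),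
      IsLifting T S' J' ∧ IsTwoIsometry S' ∧ IsMinimalLifting S' J' ∧ IsTypeI S' J' ∧
      cov S' = cov T := by
  let s : Set K := {y : K | ∃ (n : ℕ) (x : H), y = (S ^ n) (J x)}
  let L : Submodule ℂ K := (Submodule.span ℂ s).topologicalClosure
  have hLcl : IsClosed (L : Set K) := Submodule.isClosed_topologicalClosure _
  have : CompleteSpace L := hLcl.completeSpace_coe
  have hsL : s ⊆ L := Submodule.subset_span.trans (Submodule.le_topologicalClosure _)
  have hJL (x : H) : J x ∈ L := hsL ⟨0, x, rfl⟩
  have hSL (y : K) (hy : y ∈ L) : S y ∈ L := by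
    have h1 : Submodule.span ℂ s ≤ L.comap S.toLinearMap := by
      rw [Submodule.span_le]
      rintro _ ⟨n, x, rfl⟩
      exact hsL ⟨n + 1, x, (pow_succ_apply S n (J x)).symm⟩
    exact Submodule.topologicalClosure_minimal _ h1 (hLcl.preimage S.continuous) hy
  let S' : L →L[ℂ] L := (S ∘L L.subtypeL).codRestrict L fun y => hSL y y.2
  let J' : H →ₗᵢ[ℂ] L :=
    { J.toLinearMap.codRestrict L hJL with norm_map' := fun x => J.norm_map x }
  have hS'c (y : L) : ((S' y : L) : K) = S y := rfl
  have hform (y : L) : (Delta S').reApplyInnerSelf y = (Delta S).reApplyInnerSelf (y : K) := by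
    rw [re_inner_delta, re_inner_delta]; rfl
  have h2 : IsTwoIsometry S' := isTwoIsometry_iff.2 fun y => isTwoIsometry_iff.1 hS (y : K)
  have hadj (y : L) : adjoint J'.toContinuousLinearMap y
      = adjoint J.toContinuousLinearMap (y : K) := by
    refine ext_inner_left ℂ fun x => ?_
    rw [adjoint_inner_right, adjoint_inner_right]
    rfl
  have hL' : IsLifting T S' J' := by
    ext y
    rw [comp_apply, comp_apply, hadj, hadj]
    exact congrArg (fun R => R (y : K)) hL
  refine ⟨L, inferInstance, inferInstance, inferInstance, S', J', hL', h2, ?_, ?_,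
    le_antisymm ?_ (hL'.cov_le hT)⟩
  · rw [IsMinimalLifting, Submodule.eq_top_iff']
    intro y
    change y ∈ closure _
    rw [Topology.IsInducing.subtypeVal.closure_eq_preimage_closure_image]
    have hpow (n : ℕ) (x : H) : (((S' ^ n) (J' x) : L) : K) = (S ^ n) (J x) := by
      induction n with
      | zero => rfl
      | succ n ih => rw [pow_succ_apply, pow_succ_apply, hS'c, ih]
    refine closure_mono ?_ y.2
    have h1 : Submodule.span ℂ s ≤ (Submodule.span ℂ
        {y : L | ∃ (n : ℕ) (x : H), y = (S' ^ n) (J' x)}).map L.subtype := by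
      rw [Submodule.map_span]
      refine Submodule.span_mono ?_
      rintro _ ⟨n, x, rfl⟩
      exact ⟨_, ⟨n, x, rfl⟩, hpow n x⟩
    exact h1
  · intro y hy
    refine apply_eq_zero_of_reApplyInnerSelf_eq_zero h2.isConcave.delta_nonneg ?_
    rw [hform, reApplyInnerSelf_apply, hI y hy, inner_zero_left, map_zero]
  · refine le_trans (Real.sqrt_le_sqrt ?_) hcov
    refine norm_le_of_reApplyInnerSelf_le h2.isConcave.delta_nonneg (norm_nonneg _) fun y => ?_
    rw [hform]
    exact reApplyInnerSelf_le _ _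

/-- For the invariant form `A` the operator `‖Δ_T‖ A - Δ_T` is positive; with its square root `X`,
the lifting is `S (h, n) = (T h, σ X h + s n)`, where `s` is a shift and `σ` embeds `H` as a space
orthogonal to the range of `s`. Then `Δ_S = ‖Δ_T‖ A ⊕ 0`, which is `S`-invariant. -/
theorem IsConcave.exists_lifting {T : H →L[ℂ] H} (hT : IsConcave T) :
    ∃ (K : Type u) (_ : NormedAddCommGroup K) (_ : InnerProductSpace ℂ K)
      (_ : CompleteSpace K) (S : K →L[ℂ] K) (J : H →ₗᵢ[ℂ] K),
      IsLifting T S J ∧ IsTwoIsometry S ∧ IsMinimalLifting S J ∧ IsTypeI S J ∧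
      cov S = cov T := by
  obtain ⟨D, A, hD0, hDA, hA1, hTA, -, hΔ⟩ := hT.exists_invariant
  have hAsa := (hD0.trans hDA).isSelfAdjoint
  have hAT (x) : A.reApplyInnerSelf (T x) = A.reApplyInnerSelf x := by
    rw [← reApplyInnerSelf_conj, hTA]
  have hP : 0 ≤ ‖Delta T‖ • A - Delta T := by
    rw [nonneg_iff_reApplyInnerSelf (((IsSelfAdjoint.all _).smul hAsa).sub (isSelfAdjoint_Delta T))]
    intro x
    rw [reApplyInnerSelf_sub, sub_nonneg, reApplyInnerSelf_smul]
    conv_lhs => rw [hΔ, reApplyInnerSelf_smul]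
    gcongr
    exact (le_iff_reApplyInnerSelf hD0.isSelfAdjoint hAsa).1 hDA x
  obtain ⟨N, _, _, _, σ, s, hσ⟩ := exists_shift H
  set X := CFC.sqrt (‖Delta T‖ • A - Delta T)
  let S : WithLp 2 (H × N) →L[ℂ] WithLp 2 (H × N) :=
    column (T ∘L WithLp.fstL 2 ℂ H N)
      (σ ∘L X ∘L WithLp.fstL 2 ℂ H N + s ∘L WithLp.sndL 2 ℂ H N)
  let J : H →ₗᵢ[ℂ] WithLp 2 (H × N) :=
    { (column (1 : H →L[ℂ] H) (0 : H →L[ℂ] N)).toLinearMap with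
      norm_map' := fun x => by
        change ‖column (1 : H →L[ℂ] H) (0 : H →L[ℂ] N) x‖ = _
        rw [← sq_eq_sq₀ (norm_nonneg _) (norm_nonneg _), norm_sq_column]
        simp }
  have hJ (x : H) (y : WithLp 2 (H × N)) : ⟪J x, y⟫_ℂ = ⟪x, y.fst⟫_ℂ := by
    rw [WithLp.prod_inner_apply]
    change ⟪x, y.fst⟫_ℂ + ⟪(0 : N), y.snd⟫_ℂ = _
    rw [inner_zero_left, add_zero]
  have hJadj (y : WithLp 2 (H × N)) : adjoint J.toContinuousLinearMap y = y.fst := by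
    refine ext_inner_left ℂ fun x => ?_
    rw [adjoint_inner_right]
    exact hJ x y
  have hSfst (y) : (S y).fst = T y.fst := rfl
  have hSn (y) : ‖S y‖ ^ 2 = ‖y‖ ^ 2 + ‖Delta T‖ * A.reApplyInnerSelf y.fst := by
    have h1 : ‖S y‖ ^ 2 = ‖T y.fst‖ ^ 2 + ‖σ (X y.fst) + s y.snd‖ ^ 2 := norm_sq_column _ _ _
    rw [h1, hσ, norm_sqrt_apply_sq hP, reApplyInnerSelf_sub, reApplyInnerSelf_smul,
      re_inner_delta, WithLp.prod_norm_sq_eq_of_L2]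
    ring
  have hform (y) : (Delta S).reApplyInnerSelf y = ‖Delta T‖ * A.reApplyInnerSelf y.fst := by
    rw [re_inner_delta, hSn]; ring
  have h2 : IsTwoIsometry S := isTwoIsometry_iff.2 fun y => by
    rw [hSn (S y), hSn y, hSfst, hAT]; ring
  refine exists_minimal_restriction (S := S) (J := J) hT ?_ h2 ?_ ?_
  · ext y
    rw [comp_apply, comp_apply, hJadj, hJadj, hSfst]
  · intro y hy
    have hy0 : y.fst = 0 := inner_self_eq_zero.1 ((hJ _ y).symm.trans (hy y.fst))
    refine apply_eq_zero_of_reApplyInnerSelf_eq_zero h2.isConcave.delta_nonneg ?_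
    rw [hform, hy0, reApplyInnerSelf_apply, map_zero, inner_zero_left, map_zero, mul_zero]
  · refine Real.sqrt_le_sqrt (norm_le_of_reApplyInnerSelf_le h2.isConcave.delta_nonneg
      (norm_nonneg _) fun y => ?_)
    rw [hform]
    gcongr
    calc A.reApplyInnerSelf y.fst ≤ ‖y.fst‖ ^ 2 := by
          rw [← reApplyInnerSelf_one]
          exact (le_iff_reApplyInnerSelf hAsa (IsSelfAdjoint.one _)).1 hA1 y.fst
      _ ≤ ‖y‖ ^ 2 := by
          rw [WithLp.prod_norm_sq_eq_of_L2 y]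
          linarith [sq_nonneg ‖y.snd‖]

end Lifting

end ConcaveOp

theorem theorem3p9 {H : Type u} [NormedAddCommGroup H] [InnerProductSpace ℂ H] [CompleteSpace H]
    (T : H →L[ℂ] H) :
    -- (i), the equivalence
    (ConcaveOp.IsConcave T ↔
      ∃ (M₀ M₁ : Type u) (_ : NormedAddCommGroup M₀) (_ : InnerProductSpace ℂ M₀)
        (_ : CompleteSpace M₀) (_ : NormedAddCommGroup M₁) (_ : InnerProductSpace ℂ M₁)
        (_ : CompleteSpace M₁)
        (V : M₀ →L[ℂ] M₀) (E₁ : M₁ →L[ℂ] M₀) (W : M₁ →L[ℂ] M₁)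
        (Z : H →ₗᵢ[ℂ] WithLp 2 (M₀ × M₁)),
        ConcaveOp.IsModelExtension T V E₁ W Z) ∧
    -- (i), every such extension is concave with the same covariance (and forces `T` concave)
    (∀ (M₀ M₁ : Type v) [NormedAddCommGroup M₀] [InnerProductSpace ℂ M₀] [CompleteSpace M₀]
        [NormedAddCommGroup M₁] [InnerProductSpace ℂ M₁] [CompleteSpace M₁]
        (V : M₀ →L[ℂ] M₀) (E₁ : M₁ →L[ℂ] M₀) (W : M₁ →L[ℂ] M₁)
        (Z : H →ₗᵢ[ℂ] WithLp 2 (M₀ × M₁)),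
        ConcaveOp.IsModelExtension T V E₁ W Z →
          ConcaveOp.IsConcave T ∧ ConcaveOp.IsConcave (ConcaveOp.model T V E₁ W) ∧
          ConcaveOp.cov (ConcaveOp.model T V E₁ W) = ConcaveOp.cov T) ∧
    (ConcaveOp.IsConcave T →
      -- (ii), from the extension to `T`, for every such extension
      (∀ (M₀ M₁ : Type v) [NormedAddCommGroup M₀] [InnerProductSpace ℂ M₀] [CompleteSpace M₀]
          [NormedAddCommGroup M₁] [InnerProductSpace ℂ M₁] [CompleteSpace M₁]
          (V : M₀ →L[ℂ] M₀) (E₁ : M₁ →L[ℂ] M₀) (W : M₁ →L[ℂ] M₁)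
          (Z : H →ₗᵢ[ℂ] WithLp 2 (M₀ × M₁)),
          ConcaveOp.IsModelExtension T V E₁ W Z →
          ConcaveOp.DeltaStable (ConcaveOp.model T V E₁ W) →
            ConcaveOp.DeltaStable T ∧
            ConcaveOp.RootPowersTendToZero T ∧
            ConcaveOp.RootPowersTendToZero (ConcaveOp.model T V E₁ W)) ∧
      -- (ii), from `T` to the extension, for every tight extension
      (∀ (M₀ M₁ : Type v) [NormedAddCommGroup M₀] [InnerProductSpace ℂ M₀] [CompleteSpace M₀]
          [NormedAddCommGroup M₁] [InnerProductSpace ℂ M₁] [CompleteSpace M₁]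
          (V : M₀ →L[ℂ] M₀) (E₁ : M₁ →L[ℂ] M₀) (W : M₁ →L[ℂ] M₁)
          (Z : H →ₗᵢ[ℂ] WithLp 2 (M₀ × M₁)),
          ConcaveOp.IsModelExtension T V E₁ W Z → ConcaveOp.IsTight Z →
          ConcaveOp.DeltaStable T →
            ConcaveOp.DeltaStable (ConcaveOp.model T V E₁ W) ∧
            ConcaveOp.RootPowersTendToZero T ∧
            ConcaveOp.RootPowersTendToZero (ConcaveOp.model T V E₁ W)) ∧
      -- tight extensions exist
      (∃ (M₀ M₁ : Type u) (_ : NormedAddCommGroup M₀) (_ : InnerProductSpace ℂ M₀)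
          (_ : CompleteSpace M₀) (_ : NormedAddCommGroup M₁) (_ : InnerProductSpace ℂ M₁)
          (_ : CompleteSpace M₁)
          (V : M₀ →L[ℂ] M₀) (E₁ : M₁ →L[ℂ] M₀) (W : M₁ →L[ℂ] M₁)
          (Z : H →ₗᵢ[ℂ] WithLp 2 (M₀ × M₁)),
          ConcaveOp.IsModelExtension T V E₁ W Z ∧ ConcaveOp.IsTight Z) ∧
      -- (iii)
      (∃ (K : Type u) (_ : NormedAddCommGroup K) (_ : InnerProductSpace ℂ K)
          (_ : CompleteSpace K) (S : K →L[ℂ] K) (J : H →ₗᵢ[ℂ] K),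
          ConcaveOp.IsLifting T S J ∧ ConcaveOp.IsTwoIsometry S ∧
          ConcaveOp.IsMinimalLifting S J ∧ ConcaveOp.IsTypeI S J ∧
          ConcaveOp.cov S = ConcaveOp.cov T)) := by
  refine ⟨⟨fun hT => ?_, ?_⟩, ?_, fun hT => ⟨?_, ?_, hT.exists_tight_model, hT.exists_lifting⟩⟩
  · obtain ⟨M₀, M₁, i₁, i₂, i₃, i₄, i₅, i₆, V, E₁, W, Z, h, -⟩ := hT.exists_tight_model
    exact ⟨M₀, M₁, i₁, i₂, i₃, i₄, i₅, i₆, V, E₁, W, Z, h⟩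
  · rintro ⟨M₀, M₁, _, _, _, _, _, _, V, E₁, W, Z, h⟩
    exact h.isConcave
  · intro M₀ M₁ _ _ _ _ _ _ V E₁ W Z h
    exact ⟨h.isConcave, h.isConcave_model, h.cov_model⟩
  · intro M₀ M₁ _ _ _ _ _ _ V E₁ W Z h hs
    exact ⟨h.deltaStable hs, (h.deltaStable hs).rootPowersTendToZero hT,
      hs.rootPowersTendToZero h.isConcave_model⟩
  · intro M₀ M₁ _ _ _ _ _ _ V E₁ W Z h ht hs
    exact ⟨h.deltaStable_model ht hs, hs.rootPowersTendToZero hT,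
      (h.deltaStable_model ht hs).rootPowersTendToZero h.isConcave_model⟩
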